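/- Let $A$ be a separable (not necessarily unital) complex $C^*$-algebra and let $J$ be a right ideal of $A$, i.e. a linear subspace with $JA\subseteq J$ (not assumed closed or stable under the involution). Suppose that for every nonzero irreducible representation $\pi$ of $A$ (a $*$-homomorphism $\pi\neq 0$ from $A$ into the bounded operators on a complex Hilbert space $H_\pi$ such that $0$ and $H_\pi$ are the only closed $\pi(A)$-invariant subspaces), that is, for every $\pi$ in the spectrum $\widehat A$, the image $\pi(J)$ is dense in $\pi(A)$ in the operator norm. Then $J$ is dense in $A$ in norm. -/

import Mathlib

universe u

/-- A nonzero, topologically irreducible representation of a (possibly non-unital) C⋆-algebra `A` by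
bounded operators on a complex Hilbert space `H`: `π` is not the zero map, and the only closed
subspaces of `H` that are invariant under every `π a` are `0` and `H`. -/
structure IsIrreducibleRep {A : Type*} [NonUnitalCStarAlgebra A]
    {H : Type*} [NormedAddCommGroup H] [InnerProductSpace ℂ H] [CompleteSpace H]
    (π : A →⋆ₙₐ[ℂ] (H →L[ℂ] H)) : Prop where
  ne_zero : ∃ a : A, π a ≠ 0
  eq_bot_or_eq_top : ∀ K : Submodule ℂ H, IsClosed (K : Set H) →
    (∀ a : A, ∀ x ∈ K, π a x ∈ K) → K = ⊥ ∨ K = ⊤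

/-- A right ideal of a C⋆-algebra: a complex linear subspace (not assumed to be closed, nor to be
stable under the involution) that is stable under right multiplication by elements of `A`. -/
def IsRightIdeal {A : Type*} [NonUnitalCStarAlgebra A] (J : Submodule ℂ A) : Prop :=
  ∀ x ∈ J, ∀ a : A, x * a ∈ J

/-! If `x` is not in the closure of `J`, Hahn–Banach in the unitization yields a positive functional
that kills `r * star r` for `r ∈ J` but not `x * star x`. Krein–Milman on the compact convex set of
normalized such functionals gives an extreme one, `φ`. This set is a face of the state space, so the
GNS representation of `φ` is irreducible, also after restriction to `A`. For the cyclic vector `ξ`,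
`φ (r * star r) = 0` means that `star r` annihilates `ξ`. So `T ↦ ⟪ξ, T ξ⟫` vanishes on the image of
`J`, hence on its norm closure, but not at the image of `x * star x`: density fails there. -/

open scoped ComplexOrder InnerProductSpace

/-! ### Separation and extreme states in the unital case -/

section UnitalAlgebra

variable {B : Type u} [CStarAlgebra B] [PartialOrder B] [StarOrderedRing B]

/-- A right ideal contains left approximate units for each of its elements. -/
lemma IsRightIdeal.exists_approx_unit {J : Submodule ℂ B} (hJ : IsRightIdeal J) {r : B} (hr : r ∈ J)
    {ε : ℝ} (hε : 0 < ε) :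
    ∃ v : B, IsSelfAdjoint v ∧ ‖v‖ ≤ 1 ∧ 1 - v ∈ J ∧ ‖v * r‖ ≤ ε := by
  set b := r * star r with hb
  have hb0 : 0 ≤ b := mul_star_self_nonneg r
  have hbs : IsSelfAdjoint b := hb0.isSelfAdjoint
  have hsp : ∀ t ∈ spectrum ℝ b, 0 ≤ t := fun t ht ↦ spectrum_nonneg_of_nonneg hb0 ht
  -- Chosen because `t / (1 + n * t) ^ 2 ≤ 1 / n = ε ^ 2`, which bounds `‖v * r‖ ^ 2`.
  set n : ℝ := (ε ^ 2)⁻¹ with hn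
  have hn0 : 0 < n := by positivity
  have hpos : ∀ t ∈ spectrum ℝ b, 1 + n * t ≠ 0 := fun t ht ↦ by
    have := hsp t ht
    positivity
  have hc : ContinuousOn (fun t : ℝ ↦ (1 + n * t)⁻¹) (spectrum ℝ b) :=
    ContinuousOn.inv₀ (by fun_prop) hpos
  set v := cfc (fun t : ℝ ↦ (1 + n * t)⁻¹) b with hv
  have hvs : IsSelfAdjoint v := cfc_predicate _ _
  refine ⟨v, hvs, norm_cfc_le zero_le_one fun t ht ↦ ?_, ?_, ?_⟩
  · have := hsp t ht
    rw [Real.norm_eq_abs, abs_of_nonneg (by positivity)]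
    exact inv_le_one_of_one_le₀ (by nlinarith [mul_nonneg hn0.le this])
  · have key : 1 - v = b * cfc (fun t : ℝ ↦ n * (1 + n * t)⁻¹) b := by
      conv_rhs => rw [← cfc_id' ℝ b]
      rw [cfc_id' ℝ b, ← cfc_one ℝ b, hv, ← cfc_sub _ _ _ (by fun_prop) hc]
      nth_rw 2 [← cfc_id' ℝ b]
      rw [← cfc_mul (fun t : ℝ ↦ t) _ b (by fun_prop) (hc.const_mul n |>.congr fun _ _ ↦ rfl)]
      refine cfc_congr fun t ht ↦ ?_
      have := hpos t ht
      simp only [Pi.one_apply]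
      field_simp
      ring
    rw [key, hb, mul_assoc]
    exact hJ r hr _
  · rw [← sq_le_sq₀ (norm_nonneg _) hε.le, sq, ← CStarRing.norm_self_mul_star]
    have key : v * r * star (v * r) = cfc (fun t : ℝ ↦ (1 + n * t)⁻¹ * t * (1 + n * t)⁻¹) b := by
      rw [cfc_mul (fun t : ℝ ↦ (1 + n * t)⁻¹ * t) _ b (hc.mul continuousOn_id) hc, cfc_mul _ _ b hc (by fun_prop), cfc_id' ℝ b,
        star_mul, hvs.star_eq, hb]
      simp only [mul_assoc]
      rfl
    rw [key]
    refine norm_cfc_le (by positivity) fun t ht ↦ ?_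
    have h0 := hsp t ht
    rw [Real.norm_eq_abs, abs_of_nonneg (by positivity)]
    have : ε ^ 2 = n⁻¹ := by simp [hn]
    rw [this, ← mul_comm t, mul_assoc, ← mul_inv, ← div_eq_mul_inv, ← one_div,
      div_le_div_iff₀ (by positivity) hn0]
    nlinarith [mul_nonneg hn0.le h0, mul_nonneg (mul_nonneg hn0.le h0) (mul_nonneg hn0.le h0)]

/-- A positive functional whose left kernel contains `J⋆` and which does not vanish at `x * x⋆`
exists as soon as `x` is not in the closure of the right ideal `J`. -/
lemma IsRightIdeal.exists_positiveLinearMap {J : Submodule ℂ B} (hJ : IsRightIdeal J) {x : B}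
    (hx : x ∉ closure (J : Set B)) :
    ∃ f : B →ₚ[ℂ] ℂ, (∀ r ∈ J, f (r * star r) = 0) ∧ f (x * star x) ≠ 0 := by
  -- A convex cone: elements whose real part is positive modulo real parts of `J`.
  let C : Set B := {y | ∃ r ∈ J, 0 ≤ y + star y + (r + star r)}
  have hC0 : (0 : B) ∈ C := ⟨0, J.zero_mem, by simp⟩
  have hCsmul : ∀ y ∈ C, ∀ t : ℝ, 0 ≤ t → (t : ℂ) • y ∈ C := by
    rintro y ⟨r, hr, h⟩ t ht
    refine ⟨(t : ℂ) • r, J.smul_mem _ hr, ?_⟩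
    have := smul_nonneg ht h
    simpa [smul_add] using this
  have hCadd : ∀ y ∈ C, ∀ z ∈ C, y + z ∈ C := by
    rintro y ⟨r, hr, h⟩ z ⟨s, hs, h'⟩
    refine ⟨r + s, J.add_mem hr hs, (add_nonneg h h').trans_eq ?_⟩
    simp only [star_add]
    abel
  have hconv : Convex ℝ C := by
    intro y hy z hz a b ha hb _
    have := hCadd _ (hCsmul y hy a ha) _ (hCsmul z hz b hb)
    simpa using this
  -- Otherwise `2 x x⋆ ≤ (e + e⋆) + (r + r⋆)` with `e` small. Compressing by `v`, which nearly kills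
  -- `r`, makes `v * x = x - (1 - v) * x` small, while `(1 - v) * x ∈ J`.
  have hnot : -(x * star x) ∉ closure C := by
    intro hcl
    refine hx (Metric.mem_closure_iff.2 fun δ hδ ↦ ?_)
    obtain ⟨y, ⟨r, hr, hyr⟩, hy⟩ := Metric.mem_closure_iff.1 hcl (δ ^ 2 / 4) (by positivity)
    obtain ⟨v, hvs, hv1, hvJ, hvr⟩ := hJ.exists_approx_unit hr (ε := δ ^ 2 / 4) (by positivity)
    refine ⟨(1 - v) * x, hJ _ hvJ x, ?_⟩
    rw [dist_eq_norm, sub_mul, one_mul, sub_sub_cancel]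
    set e := y + x * star x with he
    have hen : ‖e‖ < δ ^ 2 / 4 := by
      rw [dist_comm, dist_eq_norm] at hy
      simpa [he] using hy
    have hle : x * star x + x * star x ≤ (e + star e) + (r + star r) := by
      rw [← sub_nonneg]
      refine hyr.trans_eq ?_
      simp only [he, star_add, star_mul, star_star]
      abel
    have hle2 := hvs.conjugate_le_conjugate hle
    have hsum : v * (x * star x + x * star x) * v = (2 : ℝ) • (v * x * star (v * x)) := by
      rw [two_smul, star_mul, hvs.star_eq]
      noncomm_ring
    have h0 : 0 ≤ v * (x * star x + x * star x) * v := by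
      rw [hsum]
      exact smul_nonneg zero_le_two (mul_star_self_nonneg _)
    have hnorm := CStarAlgebra.norm_le_norm_of_nonneg_of_le h0 hle2
    rw [hsum, norm_smul, CStarRing.norm_self_mul_star, Real.norm_ofNat] at hnorm
    have hexp : v * (e + star e + (r + star r)) * v
        = v * e * v + star (v * e * v) + (v * r * v + star (v * r * v)) := by
      simp only [star_mul, hvs.star_eq]
      noncomm_ring
    have h1 : ‖v * e * v‖ ≤ ‖e‖ := by
      calc ‖v * e * v‖ ≤ ‖v‖ * ‖e‖ * ‖v‖ := norm_mul₃_le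
        _ ≤ 1 * ‖e‖ * 1 := by gcongr
        _ = ‖e‖ := by ring
    have h2 : ‖v * r * v‖ ≤ δ ^ 2 / 4 := by
      calc ‖v * r * v‖ ≤ ‖v * r‖ * ‖v‖ := norm_mul_le _ _
        _ ≤ (δ ^ 2 / 4) * 1 := by gcongr
        _ = _ := mul_one _
    have h3 : ‖v * (e + star e + (r + star r)) * v‖
        ≤ ‖v * e * v‖ + ‖v * e * v‖ + (‖v * r * v‖ + ‖v * r * v‖) := by
      rw [hexp]
      refine (norm_add_le _ _).trans (add_le_add ?_ ?_) <;>
      exact (norm_add_le _ _).trans_eq (by rw [norm_star])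
    refine lt_of_pow_lt_pow_left₀ 2 hδ.le ?_
    nlinarith
  obtain ⟨f, u, hfC, hfx⟩ :=
    RCLike.geometric_hahn_banach_closed_point (𝕜 := ℂ) hconv.closure isClosed_closure hnot
  simp only [RCLike.re_eq_complex_re] at hfC hfx
  have hu : 0 < u := by simpa using hfC 0 (subset_closure hC0)
  have hf : ∀ y ∈ C, (f y).re ≤ 0 := by
    intro y hy
    by_contra! hlt
    have := hfC _ (subset_closure (hCsmul y hy (u / (f y).re) (by positivity)))
    simp [div_mul_cancel₀ _ hlt.ne'] at this
  -- Skew-adjoint elements have zero real part, so `C` contains both signs.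
  have him : ∀ h : B, IsSelfAdjoint h → (f h).im = 0 := by
    intro h hh
    have h1 := hf (Complex.I • h) ⟨0, J.zero_mem, by simp [hh.star_eq]⟩
    have h2 := hf (-(Complex.I • h)) ⟨0, J.zero_mem, by simp [hh.star_eq]⟩
    simp at h1 h2
    linarith
  have hpos : ∀ y : B, 0 ≤ y → 0 ≤ (-(f : B →ₗ[ℂ] ℂ)) y := by
    intro y hy
    have h1 := hf y ⟨0, J.zero_mem, by simpa [hy.isSelfAdjoint.star_eq] using add_nonneg hy hy⟩
    rw [Complex.le_def]
    simp [him y hy.isSelfAdjoint, h1]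
  refine ⟨PositiveLinearMap.mk₀ _ hpos, fun r hr ↦ ?_, fun h0 ↦ ?_⟩
  · have hs : IsSelfAdjoint (r * star r) := .mul_star_self r
    have hmem : -(r * star r) ∈ C :=
      ⟨r * star r, hJ r hr _, by simp⟩
    have h1 := hf _ hmem
    have h2 := hpos _ (mul_star_self_nonneg r)
    rw [Complex.le_def] at h2
    have h3 := him _ hs
    change -(f (r * star r)) = 0
    simp at h1 h2
    rw [neg_eq_zero]
    exact Complex.ext (by simp; linarith) h3
  · change -(f (x * star x)) = 0 at h0
    rw [map_neg, h0] at hfx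
    simp at hfx
    linarith

/-- The set of states vanishing at `r * r⋆` for all `r ∈ J`. -/
def statesVanishingOn (J : Submodule ℂ B) : Set (B → ℂ) :=
  {f | (∀ x y, f (x + y) = f x + f y) ∧ (∀ (c : ℂ) x, f (c • x) = c * f x) ∧
    (∀ x, 0 ≤ x → 0 ≤ f x) ∧ f 1 = 1 ∧ ∀ r ∈ J, f (r * star r) = 0}

/-- The positive functional underlying an element of `statesVanishingOn J`. -/
noncomputable def positiveLinearMapOfMem {J : Submodule ℂ B} {f : B → ℂ} (hf : f ∈ statesVanishingOn J) :
    B →ₚ[ℂ] ℂ :=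
  PositiveLinearMap.mk₀ { toFun := f, map_add' := hf.1, map_smul' := hf.2.1 } hf.2.2.1

@[simp]
lemma positiveLinearMapOfMem_apply {J : Submodule ℂ B} {f : B → ℂ} (hf : f ∈ statesVanishingOn J)
    (x : B) : positiveLinearMapOfMem hf x = f x := rfl

/-- Cauchy–Schwarz for the GNS form. It confines states to a product of discs, hence compactness by
Tychonoff. -/
lemma PositiveLinearMap.norm_apply_le (f : B →ₚ[ℂ] ℂ) (x : B) : ‖f x‖ ≤ ‖f 1‖ * ‖x‖ := by
  have hn (y : B) : ‖f.toPreGNS y‖ ^ 2 = ‖f (star y * y)‖ := by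
    have := f.preGNS_norm_sq (f.toPreGNS y)
    rw [f.ofPreGNS_toPreGNS] at this
    rw [← this]
    simp
  have h1 : ‖f x‖ ≤ ‖f.toPreGNS 1‖ * ‖f.toPreGNS x‖ := by
    have := norm_inner_le_norm (𝕜 := ℂ) (f.toPreGNS 1) (f.toPreGNS x)
    simpa [f.preGNS_inner_def] using this
  have h2 : ‖f (star x * x)‖ ≤ ‖f 1‖ * ‖x‖ ^ 2 := by
    have := f.norm_apply_le_of_nonneg (star x * x) (star_mul_self_nonneg x)
    rwa [CStarRing.norm_star_mul_self, ← sq] at this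
  refine (sq_le_sq₀ (norm_nonneg _) (by positivity)).1 ?_
  calc ‖f x‖ ^ 2 ≤ (‖f.toPreGNS 1‖ * ‖f.toPreGNS x‖) ^ 2 := by gcongr
    _ = ‖f 1‖ * ‖f (star x * x)‖ := by rw [mul_pow, hn, hn]; simp
    _ ≤ ‖f 1‖ * (‖f 1‖ * ‖x‖ ^ 2) := by gcongr
    _ = _ := by ring

lemma isCompact_statesVanishingOn (J : Submodule ℂ B) : IsCompact (statesVanishingOn J) := by
  refine IsCompact.of_isClosed_subset
    (isCompact_univ_pi fun x : B ↦ isCompact_closedBall (0 : ℂ) ‖x‖) ?_ ?_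
  · simp only [statesVanishingOn, Set.ofPred_and, Set.ofPred_forall]
    refine .inter ?_ (.inter ?_ (.inter ?_ (.inter ?_ ?_)))
    · exact isClosed_iInter fun x ↦ isClosed_iInter fun y ↦ isClosed_eq (by fun_prop) (by fun_prop)
    · exact isClosed_iInter fun x ↦ isClosed_iInter fun y ↦ isClosed_eq (by fun_prop) (by fun_prop)
    · exact isClosed_iInter fun x ↦ isClosed_iInter fun _ ↦ isClosed_le (by fun_prop) (by fun_prop)
    · exact isClosed_eq (by fun_prop) (by fun_prop)
    · exact isClosed_iInter fun x ↦ isClosed_iInter fun _ ↦ isClosed_eq (by fun_prop) (by fun_prop)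
  · intro f hf x _
    have := (positiveLinearMapOfMem hf).norm_apply_le x
    simpa [hf.2.2.2.1] using this

omit [StarOrderedRing B] in
lemma convex_statesVanishingOn (J : Submodule ℂ B) : Convex ℝ (statesVanishingOn J) := by
  rintro f ⟨f1, f2, f3, f4, f5⟩ g ⟨g1, g2, g3, g4, g5⟩ a b ha hb hab
  refine ⟨fun x y ↦ ?_, fun c x ↦ ?_, fun x hx ↦ ?_, ?_, fun r hr ↦ ?_⟩
  · simp [f1, g1]; ring
  · simp [f2, g2]; ring
  · exact add_nonneg (smul_nonneg ha (f3 x hx)) (smul_nonneg hb (g3 x hx))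
  · simp [f4, g4, ← Complex.ofReal_add, hab]
  · simp [f5 r hr, g5 r hr]

/-- If `x` is not in the closure of the right ideal `J`, some extreme point of the set of states
vanishing on `J` does not vanish at `x * x⋆`. -/
lemma IsRightIdeal.exists_extremePoint {J : Submodule ℂ B} (hJ : IsRightIdeal J) {x : B}
    (hx : x ∉ closure (J : Set B)) :
    ∃ f ∈ (statesVanishingOn J).extremePoints ℝ, f (x * star x) ≠ 0 := by
  obtain ⟨f, hfJ, hfx⟩ := hJ.exists_positiveLinearMap hx
  have h1 : f 1 ≠ 0 := fun h ↦ hfx (by simpa [h] using f.norm_apply_le (x * star x))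
  have hf1 : 0 ≤ f 1 := f.map_nonneg zero_le_one
  have hmem : (fun y ↦ (f 1)⁻¹ * f y) ∈ statesVanishingOn J := by
    refine ⟨fun y z ↦ by simp [mul_add], fun c y ↦ ?_, fun y hy ↦ ?_, inv_mul_cancel₀ h1,
      fun r hr ↦ by simp [hfJ r hr]⟩
    · simp only [map_smul, smul_eq_mul]; ring
    · exact mul_nonneg (inv_nonneg.2 hf1) (f.map_nonneg hy)
  by_contra! hall
  have hK := closure_convexHull_extremePoints (isCompact_statesVanishingOn J)
    (convex_statesVanishingOn J)
  let Z : Set (B → ℂ) := {g | g (x * star x) = 0}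
  have hZc : IsClosed Z := isClosed_eq (by fun_prop) (by fun_prop)
  have hZ : Convex ℝ Z := by
    intro g hg h hh a b _ _ _
    simp only [Z, Set.mem_ofPred_eq] at hg hh
    simp [Z, hg, hh]
  have := closure_minimal (convexHull_min hall hZ) hZc (hK.symm ▸ hmem)
  exact mul_ne_zero (inv_ne_zero h1) hfx this

end UnitalAlgebra
-- Irreducibility of the GNS representation of an extreme point
section GNS

variable {B : Type u} [CStarAlgebra B] [PartialOrder B] [StarOrderedRing B]

/-- The canonical cyclic vector of the GNS representation of a unital C⋆-algebra. -/
noncomputable def PositiveLinearMap.cyclicVector (f : B →ₚ[ℂ] ℂ) : f.GNS := (f.toPreGNS 1 : f.GNS)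

namespace PositiveLinearMap

lemma gnsNonUnitalStarAlgHom_cyclicVector (f : B →ₚ[ℂ] ℂ) (b : B) :
    f.gnsNonUnitalStarAlgHom b f.cyclicVector = (f.toPreGNS b : f.GNS) := by
  simp [cyclicVector]

lemma inner_cyclicVector (f : B →ₚ[ℂ] ℂ) (b : B) :
    ⟪f.cyclicVector, f.gnsNonUnitalStarAlgHom b f.cyclicVector⟫_ℂ = f b := by
  rw [gnsNonUnitalStarAlgHom_cyclicVector, cyclicVector, UniformSpace.Completion.inner_coe,
    f.preGNS_inner_def]
  simp

/-- Continuous maps agreeing on the orbit of the cyclic vector are equal. -/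
lemma ext_of_eq_on_orbit (f : B →ₚ[ℂ] ℂ) {E : Type*} [TopologicalSpace E] [T2Space E]
    {g h : f.GNS → E} (hg : Continuous g) (hh : Continuous h)
    (H : ∀ b : B, g (f.gnsNonUnitalStarAlgHom b f.cyclicVector) =
      h (f.gnsNonUnitalStarAlgHom b f.cyclicVector)) (x : f.GNS) : g x = h x := by
  induction x using UniformSpace.Completion.induction_on with
  | hp => exact isClosed_eq hg hh
  | ih a => simpa [gnsNonUnitalStarAlgHom_cyclicVector] using H (f.ofPreGNS a)

end PositiveLinearMap

/-- Vector functionals of a representation are positive. -/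
lemma inner_self_apply_nonneg {H : Type*} [NormedAddCommGroup H] [InnerProductSpace ℂ H]
    [CompleteSpace H] (π : B →⋆ₙₐ[ℂ] (H →L[ℂ] H)) (m : H) {x : B} (hx : 0 ≤ x) :
    0 ≤ ⟪m, π x m⟫_ℂ := by
  obtain ⟨y, rfl⟩ := CStarAlgebra.nonneg_iff_eq_star_mul_self.1 hx
  rw [map_mul, map_star, mul_apply_eq_comp, ContinuousLinearMap.star_eq_adjoint,
    ContinuousLinearMap.adjoint_inner_right]
  rw [inner_self_eq_norm_sq_to_K]
  rw [RCLike.ofReal_eq_complex_ofReal]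
  exact_mod_cast sq_nonneg ‖π y m‖

/-- The GNS representation of an extreme point of `statesVanishingOn J` has only trivial closed
invariant subspaces. -/
lemma gns_invariant_eq_bot_or_top {J : Submodule ℂ B} {f : B →ₚ[ℂ] ℂ}
    (hf : (f : B → ℂ) ∈ (statesVanishingOn J).extremePoints ℝ)
    (M : Submodule ℂ f.GNS) (hM : IsClosed (M : Set f.GNS))
    (hinv : ∀ b : B, ∀ x ∈ M, f.gnsNonUnitalStarAlgHom b x ∈ M) :
    M = ⊥ ∨ M = ⊤ := by
  set π := f.gnsNonUnitalStarAlgHom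
  set ξ := f.cyclicVector
  have hself (k : f.GNS) : ⟪k, k⟫_ℂ = ((‖k‖ ^ 2 : ℝ) : ℂ) := by
    rw [inner_self_eq_norm_sq_to_K]
    simp
  have hξf (b : B) : ⟪ξ, π b ξ⟫_ℂ = f b := f.inner_cyclicVector b
  have : CompleteSpace M := hM.completeSpace_coe
  obtain ⟨m, hm, n, hn, hmn⟩ := M.exists_add_mem_mem_orthogonal ξ
  have hinv' (b : B) (x) (hx : x ∈ Mᗮ) : π b x ∈ Mᗮ := by
    rw [Submodule.mem_orthogonal] at hx ⊢
    intro u hu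
    have := hx _ (hinv (star b) u hu)
    rwa [map_star, ContinuousLinearMap.star_eq_adjoint,
      ContinuousLinearMap.adjoint_inner_left] at this
  have hmn0 (b : B) : ⟪m, π b n⟫_ℂ = 0 := hinv' b n hn m hm
  have hnm0 (b : B) : ⟪n, π b m⟫_ℂ = 0 :=
    Submodule.inner_left_of_mem_orthogonal (hinv b m hm) hn
  have hsum (b : B) : f b = ⟪m, π b m⟫_ℂ + ⟪n, π b n⟫_ℂ := by
    rw [← hξf, hmn, map_add, inner_add_left, inner_add_right, inner_add_right, hmn0, hnm0]
    ring
  have hπ1 : π 1 = 1 := map_one f.gnsStarAlgHom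
  have hone : ‖m‖ ^ 2 + ‖n‖ ^ 2 = 1 := by
    have := hsum 1
    rw [hf.1.2.2.2.1, hπ1] at this
    simp only [one_apply_eq_self, hself] at this
    exact_mod_cast this.symm
  by_cases hm0 : m = 0
  · left
    have hξn : ξ ∈ Mᗮ := by rw [hmn, hm0, zero_add]; exact hn
    rw [Submodule.eq_bot_iff]
    intro x hx
    rw [← inner_self_eq_zero (𝕜 := ℂ)]
    exact f.ext_of_eq_on_orbit (g := fun y ↦ ⟪x, y⟫_ℂ) (h := fun _ ↦ 0) (by fun_prop)
      (by fun_prop) (fun b ↦ hinv' b ξ hξn x hx) x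
  right
  have hm' : 0 < ‖m‖ ^ 2 := by positivity
  by_cases hn0 : n = 0
  · have hξm : ξ ∈ M := by rw [hmn, hn0, add_zero]; exact hm
    rw [Submodule.eq_top_iff']
    intro x
    rw [← Submodule.orthogonal_orthogonal M]
    intro y hy
    exact f.ext_of_eq_on_orbit (g := fun z ↦ ⟪y, z⟫_ℂ) (h := fun _ ↦ 0) (by fun_prop)
      (by fun_prop) (fun b ↦ Submodule.inner_left_of_mem_orthogonal (hinv b ξ hξm) hy) x
  exfalso
  have hn' : 0 < ‖n‖ ^ 2 := by positivity
  have hmem (k : f.GNS) (hk : 0 < ‖k‖ ^ 2) (hle : ∀ r ∈ J, ⟪k, π (r * star r) k⟫_ℂ = 0) :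
      (fun b ↦ ((‖k‖ ^ 2 : ℝ) : ℂ)⁻¹ * ⟪k, π b k⟫_ℂ) ∈ statesVanishingOn J := by
    refine ⟨fun x y ↦ ?_, fun c x ↦ ?_, fun x hx ↦ ?_, ?_, fun r hr ↦ ?_⟩
    · simp [inner_add_right, mul_add]
    · simp [inner_smul_right]; ring
    · refine mul_nonneg (inv_nonneg.2 ?_) (inner_self_apply_nonneg π k hx)
      exact_mod_cast hk.le
    · simp only [hπ1, one_apply_eq_self, hself]
      have : ((‖k‖ ^ 2 : ℝ) : ℂ) ≠ 0 := by exact_mod_cast hk.ne'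
      exact inv_mul_cancel₀ this
    · simp only [hle r hr, mul_zero]
  -- The face property: two nonnegative terms sum to zero.
  have hvan (r : B) (hr : r ∈ J) :
      ⟪m, π (r * star r) m⟫_ℂ = 0 ∧ ⟪n, π (r * star r) n⟫_ℂ = 0 := by
    rw [← add_eq_zero_iff_of_nonneg
      (inner_self_apply_nonneg π m (mul_star_self_nonneg r))
      (inner_self_apply_nonneg π n (mul_star_self_nonneg r)), ← hsum]
    exact hf.1.2.2.2.2 r hr
  have hext := hf.2 (hmem m hm' fun r hr ↦ (hvan r hr).1) (hmem n hn' fun r hr ↦ (hvan r hr).2)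
    ⟨‖m‖ ^ 2, ‖n‖ ^ 2, hm', hn', hone, by
      funext b
      have h1 : ((‖m‖ ^ 2 : ℝ) : ℂ) ≠ 0 := by exact_mod_cast hm'.ne'
      have h2 : ((‖n‖ ^ 2 : ℝ) : ℂ) ≠ 0 := by exact_mod_cast hn'.ne'
      simp only [Pi.add_apply, Pi.smul_apply, Complex.real_smul]
      rw [mul_inv_cancel_left₀ h1, mul_inv_cancel_left₀ h2, hsum]⟩
  -- By extremality the normalized vector functional of `m` is `f`. So `m` is a nonzero multiple of
  -- `ξ`, forcing `n ∈ M ∩ Mᗮ`.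
  have hmb (b : B) : ⟪m, π b ξ⟫_ℂ = ⟪((‖m‖ ^ 2 : ℝ) : ℂ) • ξ, π b ξ⟫_ℂ := by
    have h1 : ((‖m‖ ^ 2 : ℝ) : ℂ) ≠ 0 := by exact_mod_cast hm'.ne'
    have := congrFun hext b
    beta_reduce at this
    rw [inner_smul_left, Complex.conj_ofReal, hξf, ← this, mul_inv_cancel_left₀ h1, hmn, map_add,
      inner_add_right, hmn0, add_zero]
  have hmξ : m = ((‖m‖ ^ 2 : ℝ) : ℂ) • ξ := ext_inner_right ℂ fun v ↦
    f.ext_of_eq_on_orbit (by fun_prop) (by fun_prop) hmb v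
  have h1 : ((‖m‖ ^ 2 : ℝ) : ℂ) ≠ 0 := by exact_mod_cast hm'.ne'
  have hξM : ξ ∈ M := (M.smul_mem_iff h1).1 (hmξ ▸ hm)
  have hnM : n ∈ M := by
    have := M.sub_mem hξM hm
    rwa [hmn, add_sub_cancel_left] at this
  exact hn0 (inner_self_eq_zero.1 (hn n hnM))

end GNS

/-! ### Reduction to the unitization and conclusion -/

/-- The spectrum of `A` consists of the unitary equivalence classes of irreducible representations.
Irreducible representations are cyclic, so each class has a member on a Hilbert space in the
universe of `A`; and the density of `π(J)` in `π(A)` in the operator norm depends only on the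
class of `π`. -/
theorem theorem1p1 {A : Type u} [NonUnitalCStarAlgebra A] [TopologicalSpace.SeparableSpace A]
    (J : Submodule ℂ A) (hJ : IsRightIdeal J)
    (hdense : ∀ (H : Type u) [NormedAddCommGroup H] [InnerProductSpace ℂ H] [CompleteSpace H]
      (π : A →⋆ₙₐ[ℂ] (H →L[ℂ] H)), IsIrreducibleRep π →
        Set.range π ⊆ closure (π '' (J : Set A))) :
    Dense (J : Set A) := by
  intro x
  by_contra hx
  let ι : A →⋆ₙₐ[ℂ] Unitization ℂ A := Unitization.inrNonUnitalStarAlgHom ℂ A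
  have hι : Isometry ι := Unitization.isometry_inr
  let J' : Submodule ℂ (Unitization ℂ A) := J.map (ι : A →ₗ[ℂ] Unitization ℂ A)
  have hJ'set : (J' : Set (Unitization ℂ A)) = ι '' J := rfl
  have hJ' : IsRightIdeal J' := by
    rintro _ ⟨r, hr, rfl⟩ b
    refine ⟨b.fst • r + r * b.snd, J.add_mem (J.smul_mem _ hr) (hJ r hr _), ?_⟩
    refine Unitization.ext ?_ ?_ <;> simp [ι]
  have hx' : ι x ∉ closure (J' : Set (Unitization ℂ A)) := by
    rw [hJ'set]
    rwa [hι.isEmbedding.isInducing.closure_eq_preimage_closure_image] at hx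
  obtain ⟨φ, hφ, hφx⟩ := hJ'.exists_extremePoint hx'
  let f := positiveLinearMapOfMem hφ.1
  let π := f.gnsNonUnitalStarAlgHom
  let ρ : A →⋆ₙₐ[ℂ] (f.GNS →L[ℂ] f.GNS) := π.comp ι
  have hφρ (a : A) : ⟪f.cyclicVector, ρ a f.cyclicVector⟫_ℂ = φ (ι a) :=
    f.inner_cyclicVector (ι a)
  have hxx : φ (ι (x * star x)) ≠ 0 := by rwa [map_mul, map_star]
  have hirr : IsIrreducibleRep ρ := by
    refine ⟨⟨x * star x, fun h ↦ hxx ?_⟩, fun M hM hinv ↦ ?_⟩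
    · rw [← hφρ, h]; simp
    · refine gns_invariant_eq_bot_or_top (f := f) hφ M hM fun b v hv ↦ ?_
      have hb : b = b.fst • (1 : Unitization ℂ A) + ι b.snd := by
        refine Unitization.ext ?_ ?_ <;> simp [ι]
      have h1 : π 1 = 1 := map_one f.gnsStarAlgHom
      change π b v ∈ M
      rw [hb, map_add, map_smul, h1]
      exact M.add_mem (M.smul_mem _ hv) (hinv _ v hv)
  have hJ0 (r : A) (hr : r ∈ J) : ⟪f.cyclicVector, ρ r f.cyclicVector⟫_ℂ = 0 := by
    have hker : ρ (star r) f.cyclicVector = 0 := by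
      rw [← inner_self_eq_zero (𝕜 := ℂ), ← ContinuousLinearMap.adjoint_inner_right,
        ← ContinuousLinearMap.star_eq_adjoint, ← map_star, star_star,
        ← mul_apply_eq_comp, ← map_mul, hφρ, map_mul, map_star]
      exact hφ.1.2.2.2.2 _ ⟨r, hr, rfl⟩
    rw [← ContinuousLinearMap.adjoint_inner_left, ← ContinuousLinearMap.star_eq_adjoint,
      ← map_star, hker, inner_zero_left]
  have hcl := hdense f.GNS ρ hirr ⟨x * star x, rfl⟩
  have hZ : IsClosed {T : f.GNS →L[ℂ] f.GNS | ⟪f.cyclicVector, T f.cyclicVector⟫_ℂ = 0} :=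
    isClosed_eq (by fun_prop) (by fun_prop)
  have := closure_minimal (by rintro _ ⟨r, hr, rfl⟩; exact hJ0 r hr) hZ hcl
  exact hxx ((hφρ _).symm.trans this)
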